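/- Let $\pi$ be a free abelian group (of arbitrary rank). For a discrete group $G$ let $\mathbb{C}G$ act on $\ell^2(G)$ by multiplication from the left, so that a matrix $\Delta\in M(d\times d,\mathbb{C}G)$ acts as a bounded operator on $\ell^2(G)^d$; let $A^*$ be the adjoint matrix, $(A^*)_{kl}=(a_{lk})^*$ with $(\sum_g\lambda_g g)^*=\sum_g\overline{\lambda_g}\,g^{-1}$. If $\Delta$ acts as a positive operator, its spectral density function is $F_\Delta(\lambda)=\operatorname{tr}_G\chi_{[0,\lambda]}(\Delta)$ for $\lambda\ge 0$, where $\operatorname{tr}_G(T)=\sum_{k=1}^d (Te_k,e_k)$ and $e_k\in\ell^2(G)^d$ is the unit element $1\in G$ placed in the $k$-th coordinate; thus $F_\Delta(0)=\dim_G(\ker\Delta)$. (1) Let $I$ be a non-empty directed index set, $(G_i)_{i\in I}$ an inverse system of arbitrary groups over $I$, and suppose that $\pi$ is (embedded as) a subgroup of the inverse limit $\varprojlim_{i\in I}G_i$. Let $p_i:\pi\to G_i$ be the restrictions of the natural projections. Then for every $d$ and every $A\in M(d\times d,\mathbb{C}\pi)$, with $\Delta=A^*A$, $A_i=p_i(A)\in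 M(d\times d,\mathbb{C}G_i)$ and $\Delta_i=A_i^*A_i$, \[ \lim_{i\in I}F_{\Delta_i}(0)=F_\Delta(0). \] (2) In particular, if $\pi\supset N_0\supset N_1\supset N_2\supset\cdots$ is a nested sequence of subgroups with $\bigcap_n N_n=\{1\}$ and $p_n:\pi\to\pi/N_n$ are the quotient maps, then for every $d$ and every $A\in M(d\times d,\mathbb{C}\pi)$, with $\Delta=A^*A$ and $\Delta_n=p_n(A)^*p_n(A)$, \[ \lim_{n\to\infty}F_{\Delta_n}(0)=F_\Delta(0). \] -/

import Mathlib

open Filter Topology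
open scoped ComplexConjugate

noncomputable section

namespace L2Approx

/-- The Hilbert space `ℓ²(π)` of square summable complex functions on `π`. -/
abbrev l2 (π : Type*) : Type _ := lp (fun _ : π => ℂ) 2

/-- The Hilbert sum `ℓ²(π)^d`. -/
abbrev l2Pow (π : Type*) (d : ℕ) : Type _ := PiLp 2 (fun _ : Fin d => l2 π)

section GroupRing

variable {π : Type*} [Group π]

lemma memlp_translate (g : π) (x : l2 π) :
    Memℓp (fun h : π => (x : π → ℂ) (g⁻¹ * h)) 2 := by
  have hx := lp.memℓp x
  rw [memℓp_gen_iff (by norm_num)] at hx ⊢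
  exact (Equiv.mulLeft g⁻¹).summable_iff.mpr hx

/-- Left translation by `g` on `ℓ²(π)`: `(g x)(h) = x (g⁻¹ h)`, so that `g δ_h = δ_{gh}`. -/
def translate (g : π) : l2 π →ₗᵢ[ℂ] l2 π where
  toFun x := ⟨fun h => (x : π → ℂ) (g⁻¹ * h), memlp_translate g x⟩
  map_add' _ _ := by ext; rfl
  map_smul' _ _ := by ext; rfl
  norm_map' x := by
    rw [lp.norm_eq_tsum_rpow (by norm_num), lp.norm_eq_tsum_rpow (by norm_num)]
    congr 1
    exact (Equiv.mulLeft g⁻¹).tsum_eq (fun h => ‖(x : π → ℂ) h‖ ^ (2 : ENNReal).toReal)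

@[simp] lemma translate_apply (g : π) (x : l2 π) (h : π) :
    (translate g x : π → ℂ) h = (x : π → ℂ) (g⁻¹ * h) := rfl

/-- The left regular representation of `π` on `ℓ²(π)`. -/
def leftRegular (π : Type*) [Group π] : π →* (l2 π →L[ℂ] l2 π) where
  toFun g := (translate g).toContinuousLinearMap
  map_one' := by ext x h; simp
  map_mul' a b := by ext x h; simp [mul_assoc]

/-- The action of the complex group ring on `ℓ²(π)` by multiplication from the left:
`∑ a_g g` acts as `∑ a_g L_g`. -/
def groupRingOp (π : Type*) [Group π] : MonoidAlgebra ℂ π →ₐ[ℂ] (l2 π →L[ℂ] l2 π) :=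
  MonoidAlgebra.lift ℂ (l2 π →L[ℂ] l2 π) π (leftRegular π)

/-- The bounded operator on `ℓ²(π)^d` given by a matrix over the complex group ring:
`(A x)_i = ∑ j, a_ij x_j`. -/
def matrixOp {d : ℕ} (A : Matrix (Fin d) (Fin d) (MonoidAlgebra ℂ π)) :
    l2Pow π d →L[ℂ] l2Pow π d :=
  (PiLp.continuousLinearEquiv 2 ℂ (fun _ : Fin d => l2 π)).symm.toContinuousLinearMap ∘L
    ContinuousLinearMap.pi (fun i =>
      ∑ j, groupRingOp π (A i j) ∘L PiLp.proj 2 (fun _ : Fin d => l2 π) j)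

/-- The involution `(∑ a_g g)^* = ∑ conj(a_g) g⁻¹` of the complex group ring. -/
def groupRingStar (a : MonoidAlgebra ℂ π) : MonoidAlgebra ℂ π :=
  a.coeff.sum fun g c => MonoidAlgebra.single g⁻¹ (conj c)

/-- The adjoint `A^*` of a matrix over the complex group ring: `(A^*)_ij = (a_ji)^*`. -/
def adjointMatrix {d : ℕ} (A : Matrix (Fin d) (Fin d) (MonoidAlgebra ℂ π)) :
    Matrix (Fin d) (Fin d) (MonoidAlgebra ℂ π) :=
  Matrix.of fun i j => groupRingStar (A j i)

/-- `Δ = A^* A`. -/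
def laplacian {d : ℕ} (A : Matrix (Fin d) (Fin d) (MonoidAlgebra ℂ π)) :
    Matrix (Fin d) (Fin d) (MonoidAlgebra ℂ π) :=
  adjointMatrix A * A

lemma matrixOp_apply {d : ℕ} (A : Matrix (Fin d) (Fin d) (MonoidAlgebra ℂ π)) (x : l2Pow π d)
    (i : Fin d) : matrixOp A x i = ∑ j, groupRingOp π (A i j) (x j) := by
  simp [matrixOp]

lemma matrixOp_mul {d : ℕ} (A B : Matrix (Fin d) (Fin d) (MonoidAlgebra ℂ π)) :
    matrixOp (A * B) = matrixOp A ∘L matrixOp B := by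
  ext1 x
  refine PiLp.ext fun i => ?_
  simp only [matrixOp_apply, ContinuousLinearMap.comp_apply, Matrix.mul_apply, map_sum, map_mul,
    sum_apply]
  exact Finset.sum_comm

lemma inner_translate (g : π) (x y : l2 π) :
    inner ℂ (translate g⁻¹ x) y = inner ℂ x (translate g y) := by
  have h : translate g (translate g⁻¹ x) = x := by ext h; simp
  rw [← (translate g).inner_map_map, h]

lemma inner_groupRingOp (a : MonoidAlgebra ℂ π) (x y : l2 π) :
    inner ℂ (groupRingOp π (groupRingStar a) x) y = inner ℂ x (groupRingOp π a y) := by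
  have h1 : groupRingOp π (groupRingStar a) =
      ∑ g ∈ a.coeff.support, conj (a.coeff g) • leftRegular π g⁻¹ := by
    simp only [groupRingStar, groupRingOp, Finsupp.sum, map_sum, MonoidAlgebra.lift_single]
  have h2 : groupRingOp π a = ∑ g ∈ a.coeff.support, a.coeff g • leftRegular π g := by
    simp only [groupRingOp, Finsupp.sum, MonoidAlgebra.lift_apply]
  rw [h1, h2]
  simp only [sum_apply, sum_inner, inner_sum, smul_apply, inner_smul_left, inner_smul_right,
    Complex.conj_conj]
  exact Finset.sum_congr rfl fun g _ => congrArg _ (inner_translate g x y)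

/-- The operator of the matrix `A^*` is the Hilbert space adjoint of the operator of `A`. -/
lemma matrixOp_adjointMatrix {d : ℕ} (A : Matrix (Fin d) (Fin d) (MonoidAlgebra ℂ π)) :
    matrixOp (adjointMatrix A) = ContinuousLinearMap.adjoint (matrixOp A) := by
  rw [ContinuousLinearMap.eq_adjoint_iff]
  intro x y
  simp only [PiLp.inner_apply, matrixOp_apply, adjointMatrix, Matrix.of_apply, sum_inner,
    inner_sum, inner_groupRingOp]
  exact Finset.sum_comm

/-- The matrix `Δ = A^* A` acts as a positive operator. -/
lemma matrixOp_laplacian_nonneg {d : ℕ} (A : Matrix (Fin d) (Fin d) (MonoidAlgebra ℂ π)) :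
    0 ≤ matrixOp (laplacian A) := by
  rw [laplacian, matrixOp_mul, matrixOp_adjointMatrix, ContinuousLinearMap.nonneg_iff_isPositive]
  exact ContinuousLinearMap.isPositive_adjoint_comp_self _

/-- The image `p(A)` of a matrix over `ℂπ` under the ring homomorphism `ℂπ → ℂG` that a group
homomorphism `p : π → G` induces. -/
def mapMatrix {G : Type*} [Group G] (p : π →* G) {d : ℕ}
    (A : Matrix (Fin d) (Fin d) (MonoidAlgebra ℂ π)) :
    Matrix (Fin d) (Fin d) (MonoidAlgebra ℂ G) :=
  A.map (MonoidAlgebra.mapDomainRingHom ℂ p)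

/-- The vector of `ℓ²(π)^d` with `δ_1` in the `k`-th coordinate and `0` elsewhere. -/
def unitVector (π : Type*) [Group π] {d : ℕ} (k : Fin d) : l2Pow π d :=
  letI := Classical.decEq π
  PiLp.single 2 k (lp.single 2 (1 : π) (1 : ℂ))

/-- The trace `tr_π(T) = ∑ k, (T_kk δ_1, δ_1)` of an operator on `ℓ²(π)^d`. -/
def vnTrace {d : ℕ} (T : l2Pow π d →L[ℂ] l2Pow π d) : ℂ :=
  ∑ k, inner ℂ (unitVector π k) (T (unitVector π k))

end GroupRing

section Spectral

variable {H : Type*} [NormedAddCommGroup H] [InnerProductSpace ℂ H] [CompleteSpace H]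

/-- The spectral family of a bounded self-adjoint operator `T`: the orthogonal projection onto
the kernel of the positive part `(T - t)^+`, which is `χ_{(-∞, t]}(T)`. If `T` is positive, then
this is `χ_{[0, t]}(T)` for `t ≥ 0`. -/
def spectralProjection (T : H →L[ℂ] H) (t : ℝ) : H →L[ℂ] H :=
  (cfc (fun x : ℝ => max (x - t) 0) T).ker.starProjection

/-- For a positive operator, `χ_{[0, 0]}(T)` is the orthogonal projection onto the kernel. -/
lemma spectralProjection_zero (T : H →L[ℂ] H) (hT : 0 ≤ T) :
    spectralProjection T 0 = T.ker.starProjection := by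
  have h : cfc (fun x : ℝ => max (x - 0) 0) T = T := by
    have hsa : IsSelfAdjoint T := IsSelfAdjoint.of_nonneg hT
    conv_rhs => rw [← cfc_id ℝ T]
    refine cfc_congr fun x hx => ?_
    simpa using spectrum_nonneg_of_nonneg hT hx
  simp only [spectralProjection, h]

end Spectral

section GroupRing

variable {π : Type*} [Group π]

/-- The spectral density function `F_Δ(t) = tr_π χ_{[0, t]}(Δ)` of a matrix `Δ` over the complex
group ring that acts as a positive operator. The trace of a projection is real. -/
def spectralDensity {d : ℕ} (D : Matrix (Fin d) (Fin d) (MonoidAlgebra ℂ π)) (t : ℝ) : ℝ :=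
  (vnTrace (spectralProjection (matrixOp D) t)).re

end GroupRing

/-- The inverse limit of an inverse system of groups, as the group of coherent families. -/
def inverseLimit {I : Type*} [Preorder I] {G : I → Type*} [∀ i, Group (G i)]
    (f : ∀ ⦃i j : I⦄, i ≤ j → G j →* G i) : Subgroup (∀ i, G i) where
  carrier := {x | ∀ ⦃i j : I⦄ (h : i ≤ j), f h (x j) = x i}
  mul_mem' hx hy i j h := by simp [hx h, hy h]
  one_mem' i j h := by simp
  inv_mem' hx i j h := by simp [hx h]

/-- The natural projection from the inverse limit to the `i`-th group of the system. -/
def inverseLimitProj {I : Type*} [Preorder I] {G : I → Type*} [∀ i, Group (G i)]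
    (f : ∀ ⦃i j : I⦄, i ≤ j → G j →* G i) (i : I) : inverseLimit f →* G i :=
  (Pi.evalMonoidHom G i).comp (inverseLimit f).subtype

end L2Approx

end

/-! Since `π` is torsion-free, the group ring `ℂπ` is a commutative domain. Over its fraction field
a matrix `A` can be diagonalized by transvections; clearing denominators gives `U A V = diag(D)`
with `U' U = c₁`, `V V' = c₂` nonzero scalars. Kernel dimension grows under multiplication on either
side, and a scalar factor `c` adds at most the kernel dimension of `c`. Hence, up to errors coming
from `c₁` and `c₂`, the kernel of `p_i(A)` has the dimension of the kernel of `p_i(diag(D))`.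

For a diagonal matrix, Fourier analysis on the compact group of characters of `π` trivial on `ker
p_i` turns this dimension into the Haar measure of the zero sets of the entries
(`kerDim_mapMatrix_diagonal`). The zero set of a nonzero element has measure bounded in terms of the
number of its terms and of how often two of its characters agree (`haarProb_zeroSet_le`). As the
kernels leave every nontrivial element, this bound tends to zero, so the dimension tends to the
number of zeros among the `D k`, which is also the dimension over `π` itself.

Kernel dimensions are handled through traces: by the mean ergodic theorem they are Cesàro limits of
the traces of powers of `1 - t S^* S`. -/

noncomputable section

namespace L2Approx

open MeasureTheory

/-! ### Kernels and contractions on a Hilbert space -/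

section Hilbert

variable {H : Type*} [NormedAddCommGroup H] [InnerProductSpace ℂ H]

lemma re_inner_starProjection (U : Submodule ℂ H) [U.HasOrthogonalProjection] (x : H) :
    (inner ℂ x (U.starProjection x)).re = ‖U.starProjection x‖ ^ 2 := by
  have h := Submodule.inner_starProjection_left_eq_right U (U.starProjection x) x
  have h2 : U.starProjection (U.starProjection x) = U.starProjection x :=
    Submodule.starProjection_eq_self_iff.mpr (U.starProjection_apply_mem x)
  rw [← Submodule.inner_starProjection_left_eq_right, ← h2,
    Submodule.inner_starProjection_left_eq_right, h2, inner_self_eq_norm_sq_to_K]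
  norm_cast

lemma norm_starProjection_le_of_le {U V : Submodule ℂ H} [U.HasOrthogonalProjection]
    [V.HasOrthogonalProjection] (h : U ≤ V) (x : H) :
    ‖U.starProjection x‖ ≤ ‖V.starProjection x‖ := by
  have : U.starProjection (V.starProjection x) = U.starProjection x :=
    DFunLike.congr_fun (Submodule.starProjection_comp_starProjection_of_le h) x
  rw [← this]
  exact U.norm_starProjection_apply_le _

variable [CompleteSpace H]

lemma ker_adjoint_comp_self (S : H →L[ℂ] H) :
    (ContinuousLinearMap.adjoint S ∘L S).ker = S.ker := by
  ext x
  simp only [LinearMap.mem_ker, ContinuousLinearMap.coe_coe, ContinuousLinearMap.comp_apply]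
  constructor
  · intro h
    have : inner ℂ (S x) (S x) = 0 := by
      rw [← ContinuousLinearMap.adjoint_inner_left, h, inner_zero_left]
    exact inner_self_eq_zero.mp this
  · intro h
    rw [h, map_zero]

/-- If `C` commutes with `B` and with the adjoint of `B`, then
`ker (C B) = ker C ⊕ (ker B ∩ (ker C)ᗮ)`, so that projections onto the kernels are subadditive. -/
lemma norm_sq_starProjection_ker_comp_le (C B : H →L[ℂ] H) (h : C ∘L B = B ∘L C)
    (h' : C ∘L ContinuousLinearMap.adjoint B = ContinuousLinearMap.adjoint B ∘L C) (e : H) :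
    ‖(C ∘L B).ker.starProjection e‖ ^ 2 ≤
      ‖C.ker.starProjection e‖ ^ 2 + ‖B.ker.starProjection e‖ ^ 2 := by
  set y := (C ∘L B).ker.starProjection e with hy
  have hyk : C (B y) = 0 := (C ∘L B).ker.starProjection_apply_mem e
  set u := C.ker.starProjection y with hu
  have huk : C u = 0 := C.ker.starProjection_apply_mem y
  set v := y - u with hv
  have hvo : v ∈ C.kerᗮ := C.ker.sub_starProjection_mem_orthogonal y
  have hcomm : ∀ x, C (B x) = B (C x) := fun x => DFunLike.congr_fun h x
  have hcomm' : ∀ x, C (ContinuousLinearMap.adjoint B x) = ContinuousLinearMap.adjoint B (C x) :=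
    fun x => DFunLike.congr_fun h' x
  -- `B v` lies in `ker C`, and also in its orthogonal complement because the adjoint of `B`
  -- preserves `ker C`.
  have hBv : B v = 0 := by
    have h1 : B v ∈ C.ker := by
      change C (B v) = 0
      rw [hv, map_sub, map_sub, hyk, hcomm u, huk, map_zero, sub_zero]
    have h2 : B v ∈ C.kerᗮ := by
      rw [Submodule.mem_orthogonal]
      intro w hw
      rw [← ContinuousLinearMap.adjoint_inner_left]
      refine Submodule.inner_right_of_mem_orthogonal (K := C.ker) ?_ hvo
      change C _ = 0
      rw [hcomm', show C w = 0 from hw, map_zero]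
    exact inner_self_eq_zero.mp (Submodule.inner_right_of_mem_orthogonal h1 h2)
  have huv : inner ℂ u v = 0 := Submodule.inner_right_of_mem_orthogonal (K := C.ker) huk hvo
  have hyuv : y = u + v := by rw [hv]; abel
  have hnorm : ‖y‖ ^ 2 = ‖u‖ ^ 2 + ‖v‖ ^ 2 := by
    rw [hyuv, sq, sq, sq]
    exact norm_add_sq_eq_norm_sq_add_norm_sq_of_inner_eq_zero u v huv
  have hye : ‖y‖ ^ 2 = (inner ℂ u e).re + (inner ℂ v e).re := by
    rw [← Complex.add_re, ← inner_add_left, ← hyuv, hy, ← re_inner_starProjection,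
      Submodule.inner_starProjection_left_eq_right]
  have h3 : ∀ (U : Submodule ℂ H) [U.HasOrthogonalProjection] (w : H), w ∈ U →
      (inner ℂ w e).re ≤ ‖w‖ * ‖U.starProjection e‖ := by
    intro U _ w hw
    have : inner ℂ w e = inner ℂ w (U.starProjection e) := by
      rw [← Submodule.inner_starProjection_left_eq_right,
        Submodule.starProjection_eq_self_iff.mpr hw]
    rw [this]
    exact (Complex.re_le_norm _).trans (norm_inner_le_norm _ _)
  have h4 := h3 C.ker u huk
  have h5 := h3 B.ker v hBv
  -- With `a`, `b` the norms of the two projections of `e`, `‖u‖² + ‖v‖² ≤ ‖u‖ a + ‖v‖ b`, and the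
  -- right side is at most `(‖u‖² + ‖v‖² + a² + b²) / 2`.
  nlinarith [sq_nonneg (‖u‖ - ‖C.ker.starProjection e‖),
    sq_nonneg (‖v‖ - ‖B.ker.starProjection e‖)]

/-- Expanding the square gives `‖x - t S^* S x‖² ≤ ‖x‖² - t ‖S x‖² (2 - t ‖S‖²)`. -/
lemma norm_one_sub_smul_adjoint_comp_le (S : H →L[ℂ] H) {t : ℝ} (ht : 0 ≤ t)
    (ht' : t * ‖S‖ ^ 2 ≤ 2) :
    ‖1 - (t : ℂ) • (ContinuousLinearMap.adjoint S ∘L S)‖ ≤ 1 := by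
  refine ContinuousLinearMap.opNorm_le_bound _ zero_le_one fun x => ?_
  rw [one_mul]
  refine le_of_sq_le_sq ?_ (norm_nonneg x)
  set y := ContinuousLinearMap.adjoint S (S x) with hy
  have h1 : (1 - (t : ℂ) • (ContinuousLinearMap.adjoint S ∘L S)) x = x - (t : ℂ) • y := by
    simp [hy]
  have h2 : (inner ℂ x y).re = ‖S x‖ ^ 2 := by
    rw [hy, ContinuousLinearMap.adjoint_inner_right, inner_self_eq_norm_sq_to_K]
    norm_cast
  have h3 : ‖y‖ ≤ ‖S‖ * ‖S x‖ := by
    rw [hy, ← LinearIsometryEquiv.norm_map ContinuousLinearMap.adjoint S]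
    exact ContinuousLinearMap.le_opNorm _ _
  have h4 : ‖y‖ ^ 2 ≤ ‖S‖ ^ 2 * ‖S x‖ ^ 2 := by
    rw [← mul_pow]; gcongr
  rw [h1, @norm_sub_sq ℂ, inner_smul_right, norm_smul]
  have h5 : RCLike.re ((t : ℂ) * inner ℂ x y) = t * ‖S x‖ ^ 2 := by
    rw [← h2]; simp
  rw [h5, Complex.norm_real, Real.norm_eq_abs, abs_of_nonneg ht, mul_pow]
  have h6 : t ^ 2 * ‖y‖ ^ 2 ≤ t ^ 2 * (‖S‖ ^ 2 * ‖S x‖ ^ 2) := by gcongr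
  have h7 : t * ‖S x‖ ^ 2 * (t * ‖S‖ ^ 2) ≤ t * ‖S x‖ ^ 2 * 2 := by gcongr
  nlinarith

/-- The mean ergodic theorem for the contraction `1 - t S^* S`. -/
lemma tendsto_average_inner_pow (S : H →L[ℂ] H) {t : ℝ} (ht : 0 < t) (ht' : t * ‖S‖ ^ 2 ≤ 2)
    (x : H) :
    Tendsto (fun n : ℕ => (n : ℝ)⁻¹ * ∑ j ∈ Finset.range n,
      (inner ℂ x (((1 - (t : ℂ) • (ContinuousLinearMap.adjoint S ∘L S)) ^ j) x)).re) atTop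
      (𝓝 (‖S.ker.starProjection x‖ ^ 2)) := by
  set f := 1 - (t : ℂ) • (ContinuousLinearMap.adjoint S ∘L S) with hf
  have key := ContinuousLinearMap.tendsto_birkhoffAverage_orthogonalProjection f
    (norm_one_sub_smul_adjoint_comp_le S ht.le ht') x
  -- The fixed vectors of the contraction are the kernel of `S^* S`, hence of `S`.
  have hloc : f.eqLocus (1 : H →L[ℂ] H) = S.ker := by
    rw [← ker_adjoint_comp_self S]
    ext z
    simp [hf, ht.ne']
  have key2 : Tendsto (birkhoffAverage ℂ f _root_.id · x) atTop (𝓝 (S.ker.starProjection x)) := by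
    have : ((f.eqLocus (1 : H →L[ℂ] H)).orthogonalProjectionOnto x : H) =
        S.ker.starProjection x := by
      have aux : ∀ (U V : Submodule ℂ H) [U.HasOrthogonalProjection] [V.HasOrthogonalProjection],
          U = V → (U.orthogonalProjectionOnto x : H) = V.starProjection x := by
        intro U V _ _ hUV
        subst hUV
        rfl
      exact aux _ _ hloc
    rwa [← this]
  have key3 := (Complex.continuous_re.tendsto _).comp
    ((tendsto_const_nhds (x := x)).inner (𝕜 := ℂ) key2)
  rw [re_inner_starProjection] at key3
  refine key3.congr fun n => ?_
  simp only [Function.comp_apply, birkhoffAverage, birkhoffSum, id_eq, inner_smul_right, inner_sum]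
  rw [show ((n : ℂ)⁻¹) = (((n : ℝ)⁻¹ : ℝ) : ℂ) by push_cast; rfl, Complex.re_ofReal_mul,
    Complex.re_sum]
  simp only [← FunLike.coe_pow_eq_iterate]

end Hilbert

/-! ### Kernel dimension and trace over a group ring -/

section GroupRing

variable {G : Type*} [Group G] {d : ℕ}

/-- The von Neumann dimension of the kernel of an operator on `ℓ²(G)^d`. -/
def kerDim (S : l2Pow G d →L[ℂ] l2Pow G d) : ℝ :=
  ∑ k, ‖S.ker.starProjection (unitVector G k)‖ ^ 2

lemma spectralDensity_laplacian_zero (X : Matrix (Fin d) (Fin d) (MonoidAlgebra ℂ G)) :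
    spectralDensity (laplacian X) 0 = kerDim (matrixOp X) := by
  rw [spectralDensity, spectralProjection_zero _ (matrixOp_laplacian_nonneg X), laplacian,
    matrixOp_mul, matrixOp_adjointMatrix, vnTrace, Complex.re_sum, kerDim]
  simp only [ker_adjoint_comp_self, re_inner_starProjection]

lemma kerDim_mono {S T : l2Pow G d →L[ℂ] l2Pow G d} (h : S.ker ≤ T.ker) :
    kerDim S ≤ kerDim T :=
  Finset.sum_le_sum fun _ _ =>
    pow_le_pow_left₀ (norm_nonneg _) (norm_starProjection_le_of_le h _) 2

lemma kerDim_le_comp_left (S T : l2Pow G d →L[ℂ] l2Pow G d) : kerDim T ≤ kerDim (S ∘L T) :=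
  kerDim_mono fun x (hx : T x = 0) => by
    change S (T x) = 0
    rw [hx, map_zero]

lemma kerDim_comp_le (C B : l2Pow G d →L[ℂ] l2Pow G d) (h : C ∘L B = B ∘L C)
    (h' : C ∘L ContinuousLinearMap.adjoint B = ContinuousLinearMap.adjoint B ∘L C) :
    kerDim (C ∘L B) ≤ kerDim C + kerDim B := by
  rw [kerDim, kerDim, kerDim, ← Finset.sum_add_distrib]
  exact Finset.sum_le_sum fun k _ => norm_sq_starProjection_ker_comp_le C B h h' _

/-- The trace of a matrix over the group ring: the sum of the coefficients of `1` in the diagonal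
entries. -/
def coeffTrace (M : Matrix (Fin d) (Fin d) (MonoidAlgebra ℂ G)) : ℂ :=
  ∑ k, (M k k).coeff 1

lemma coeff_one_mul_comm (a b : MonoidAlgebra ℂ G) : (a * b).coeff 1 = (b * a).coeff 1 := by
  induction a using MonoidAlgebra.induction_linear with
  | zero => simp
  | add x y hx hy => simp [add_mul, mul_add, hx, hy]
  | single g r =>
    rw [MonoidAlgebra.coeff_single_mul_apply, MonoidAlgebra.coeff_mul_single_apply, mul_one,
      one_mul, mul_comm]

lemma coeffTrace_mul_comm (M N : Matrix (Fin d) (Fin d) (MonoidAlgebra ℂ G)) :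
    coeffTrace (M * N) = coeffTrace (N * M) := by
  simp only [coeffTrace, Matrix.mul_apply, MonoidAlgebra.coeff_sum, Finsupp.finsetSum_apply]
  rw [Finset.sum_comm]
  exact Finset.sum_congr rfl fun _ _ => Finset.sum_congr rfl fun _ _ => coeff_one_mul_comm _ _

/-- Moving `M` across the powers by `(1 - c M N)^n M = M (1 - c N M)^n` reduces the claim to the
trace property. This makes `A^* A` and `A A^*` indistinguishable by traces. -/
lemma coeffTrace_pow_one_sub_mul_comm (M N : Matrix (Fin d) (Fin d) (MonoidAlgebra ℂ G)) (c : ℂ)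
    (n : ℕ) : coeffTrace ((1 - c • (M * N)) ^ n) = coeffTrace ((1 - c • (N * M)) ^ n) := by
  have hsub : ∀ X Y : Matrix (Fin d) (Fin d) (MonoidAlgebra ℂ G),
      coeffTrace (X - Y) = coeffTrace X - coeffTrace Y := fun X Y => by
    simp [coeffTrace]
  have hsmul : ∀ X : Matrix (Fin d) (Fin d) (MonoidAlgebra ℂ G),
      coeffTrace (c • X) = c * coeffTrace X := fun X => by
    simp [coeffTrace, Finset.mul_sum]
  have hcomm : ∀ n, (1 - c • (M * N)) ^ n * M = M * (1 - c • (N * M)) ^ n := by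
    intro n
    induction n with
    | zero => simp
    | succ n ih =>
      rw [pow_succ, mul_assoc, sub_mul, one_mul, smul_mul_assoc, mul_assoc M N M,
        show M - c • (M * (N * M)) = M * (1 - c • (N * M)) by
          rw [mul_sub, mul_one, mul_smul_comm],
        ← mul_assoc, ih, mul_assoc, ← pow_succ]
  induction n with
  | zero => simp
  | succ n ih =>
    rw [pow_succ, pow_succ, mul_sub, mul_sub, mul_one, mul_one, hsub, hsub, ih, mul_smul_comm,
      mul_smul_comm, hsmul, hsmul, ← mul_assoc, hcomm, mul_assoc, coeffTrace_mul_comm M, mul_assoc]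

lemma groupRingOp_single_one (a : MonoidAlgebra ℂ G) [DecidableEq G] (h : G) :
    (groupRingOp G a (lp.single 2 (1 : G) (1 : ℂ)) : G → ℂ) h = a.coeff h := by
  induction a using MonoidAlgebra.induction_linear with
  | zero => simp
  | add x y hx hy => simp [hx, hy]
  | single g r =>
    rw [groupRingOp, MonoidAlgebra.lift_single]
    change r • (translate g (lp.single 2 (1 : G) (1 : ℂ)) : G → ℂ) h = _
    rw [translate_apply]
    by_cases hg : g = h
    · subst hg; simp
    · have : g⁻¹ * h ≠ 1 := fun h' => hg (inv_mul_eq_one.mp h')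
      simp [this, hg]

lemma vnTrace_matrixOp (M : Matrix (Fin d) (Fin d) (MonoidAlgebra ℂ G)) :
    vnTrace (matrixOp M) = coeffTrace M := by
  classical
  refine Finset.sum_congr rfl fun k _ => ?_
  have hu : unitVector G k = PiLp.single 2 k (lp.single 2 (1 : G) (1 : ℂ)) := by
    unfold unitVector
    congr!
  have h1 : matrixOp M (PiLp.single 2 k (lp.single 2 (1 : G) (1 : ℂ))) k =
      groupRingOp G (M k k) (lp.single 2 (1 : G) (1 : ℂ)) := by
    rw [matrixOp_apply, Finset.sum_eq_single k]
    · simp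
    · intro j _ hj
      simp [hj]
    · simp
  rw [hu, PiLp.inner_apply, Finset.sum_eq_single k]
  · rw [h1, PiLp.single_eq_same, lp.inner_single_left, groupRingOp_single_one]
    simp
  · intro j _ hj
    simp [hj]
  · simp

lemma matrixOp_one : matrixOp (1 : Matrix (Fin d) (Fin d) (MonoidAlgebra ℂ G)) = 1 := by
  ext1 x
  refine PiLp.ext fun i => ?_
  rw [matrixOp_apply, Finset.sum_eq_single i]
  · simp
  · intro j _ hj
    simp [Matrix.one_apply_ne hj.symm]
  · simp

lemma matrixOp_one_sub_smul (c : ℂ) (M : Matrix (Fin d) (Fin d) (MonoidAlgebra ℂ G)) :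
    matrixOp (1 - c • M) = 1 - c • matrixOp M := by
  rw [← matrixOp_one]
  ext1 x
  refine PiLp.ext fun i => ?_
  simp [matrixOp_apply, Finset.smul_sum]

lemma matrixOp_pow (M : Matrix (Fin d) (Fin d) (MonoidAlgebra ℂ G)) (n : ℕ) :
    matrixOp (M ^ n) = matrixOp M ^ n := by
  induction n with
  | zero => rw [pow_zero, pow_zero, matrixOp_one]
  | succ n ih => rw [pow_succ, pow_succ, matrixOp_mul, ih]; rfl

/-- The kernel dimension is thereby determined by coefficients of `1` in the group ring. `S` is kept
separate from `M` so that both `X^* X` and `X X^*` can be treated. -/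
lemma tendsto_average_coeffTrace (M : Matrix (Fin d) (Fin d) (MonoidAlgebra ℂ G))
    (S : l2Pow G d →L[ℂ] l2Pow G d) (hM : matrixOp M = ContinuousLinearMap.adjoint S ∘L S)
    {t : ℝ} (ht : 0 < t) (ht' : t * ‖S‖ ^ 2 ≤ 2) :
    Tendsto (fun n : ℕ => (n : ℝ)⁻¹ * ∑ j ∈ Finset.range n,
      (coeffTrace ((1 - (t : ℂ) • M) ^ j)).re) atTop (𝓝 (kerDim S)) := by
  have key := tendsto_finsetSum (Finset.univ : Finset (Fin d)) fun k _ =>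
    tendsto_average_inner_pow S ht ht' (unitVector G k)
  refine key.congr fun n => ?_
  rw [← Finset.mul_sum, Finset.sum_comm]
  congr 1
  refine Finset.sum_congr rfl fun j _ => ?_
  rw [← vnTrace_matrixOp, matrixOp_pow, matrixOp_one_sub_smul, hM, vnTrace, Complex.re_sum]

lemma eventually_mul_le_one (c : ℝ) : ∀ᶠ t : ℝ in 𝓝[>] 0, t * c ≤ 1 := by
  have h : Tendsto (fun t : ℝ => t * c) (𝓝[>] 0) (𝓝 0) := by
    have : Continuous fun t : ℝ => t * c := by fun_prop
    simpa using (this.tendsto 0).mono_left nhdsWithin_le_nhds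
  exact h.eventually_le_const one_pos

/-- Both dimensions are limits of the same averages of traces, for one `t` small enough for both
operators. -/
lemma kerDim_adjoint (X : Matrix (Fin d) (Fin d) (MonoidAlgebra ℂ G)) :
    kerDim (ContinuousLinearMap.adjoint (matrixOp X)) = kerDim (matrixOp X) := by
  obtain ⟨t, h1, h2, ht⟩ := ((eventually_mul_le_one (‖matrixOp X‖ ^ 2)).and
    ((eventually_mul_le_one (‖ContinuousLinearMap.adjoint (matrixOp X)‖ ^ 2)).and
      self_mem_nhdsWithin)).exists
  refine tendsto_nhds_unique (tendsto_average_coeffTrace (X * adjointMatrix X) _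
    (by rw [matrixOp_mul, matrixOp_adjointMatrix, ContinuousLinearMap.adjoint_adjoint]) ht
    (h2.trans one_le_two)) ?_
  simp only [coeffTrace_pow_one_sub_mul_comm X]
  exact tendsto_average_coeffTrace _ _ (by rw [matrixOp_mul, matrixOp_adjointMatrix]) ht
    (h1.trans one_le_two)

lemma kerDim_le_mul_left (X Y : Matrix (Fin d) (Fin d) (MonoidAlgebra ℂ G)) :
    kerDim (matrixOp Y) ≤ kerDim (matrixOp (X * Y)) := by
  rw [matrixOp_mul]
  exact kerDim_le_comp_left _ _

/-- The kernel of `X^*` is contained in that of `(X Y)^* = Y^* X^*`, and passing to adjoints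
preserves the dimension. -/
lemma kerDim_le_mul_right (X Y : Matrix (Fin d) (Fin d) (MonoidAlgebra ℂ G)) :
    kerDim (matrixOp X) ≤ kerDim (matrixOp (X * Y)) := by
  rw [← kerDim_adjoint, ← kerDim_adjoint (X * Y), matrixOp_mul, ContinuousLinearMap.adjoint_comp]
  exact kerDim_le_comp_left _ _

lemma kerDim_mul_le (C B : Matrix (Fin d) (Fin d) (MonoidAlgebra ℂ G)) (h : C * B = B * C)
    (h' : C * adjointMatrix B = adjointMatrix B * C) :
    kerDim (matrixOp (C * B)) ≤ kerDim (matrixOp C) + kerDim (matrixOp B) := by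
  rw [matrixOp_mul]
  refine kerDim_comp_le _ _ ?_ ?_
  · rw [← matrixOp_mul, h, matrixOp_mul]
  · rw [← matrixOp_adjointMatrix, ← matrixOp_mul, h', matrixOp_mul]

end GroupRing

/-! ### Characters, Haar measure and zero sets of trigonometric polynomials -/

section Characters

instance : SecondCountableTopology Circle :=
  inferInstanceAs (SecondCountableTopology (Submonoid.unitSphere ℂ : Set ℂ))

variable {π : Type*} [CommGroup π]

/-- The compact group of those characters of the discrete group `π` that are trivial on `N`, with
the topology of pointwise convergence. -/
def characterGroup (N : Subgroup π) : Subgroup (π → Circle) where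
  carrier := {χ | (∀ a b, χ (a * b) = χ a * χ b) ∧ ∀ n ∈ N, χ n = 1}
  mul_mem' hx hy :=
    ⟨fun a b => by simp only [Pi.mul_apply, hx.1, hy.1]; exact mul_mul_mul_comm _ _ _ _,
      fun n hn => by simp only [Pi.mul_apply, hx.2 n hn, hy.2 n hn, mul_one]⟩
  one_mem' := ⟨fun _ _ => by simp, fun _ _ => rfl⟩
  inv_mem' hx := ⟨fun a b => by simp only [Pi.inv_apply, hx.1, mul_inv],
    fun n hn => by simp only [Pi.inv_apply, hx.2 n hn, inv_one]⟩

variable (N : Subgroup π)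

instance : CompactSpace (characterGroup N) := by
  have : IsClosed ((characterGroup N : Subgroup (π → Circle)) : Set (π → Circle)) := by
    change IsClosed {χ : π → Circle | (∀ a b, χ (a * b) = χ a * χ b) ∧ ∀ n ∈ N, χ n = 1}
    simp only [Set.ofPred_and, Set.ofPred_forall]
    refine IsClosed.inter ?_ ?_
    · exact isClosed_iInter fun a => isClosed_iInter fun b =>
        isClosed_eq (by fun_prop) (by fun_prop)
    · exact isClosed_iInter fun n => isClosed_iInter fun _ =>
        isClosed_eq (by fun_prop) (by fun_prop)
  exact isCompact_iff_compactSpace.mp this.isCompact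

instance : MeasurableSpace (characterGroup N) := borel _

instance : BorelSpace (characterGroup N) := ⟨rfl⟩

/-- The Haar probability measure on the group of characters that are trivial on `N`. -/
def haarProb : Measure (characterGroup N) :=
  letI : Top (TopologicalSpace.PositiveCompacts (characterGroup N)) := inferInstance
  Measure.haarMeasure ⊤

instance : IsProbabilityMeasure (haarProb N) := ⟨Measure.haarMeasure_self (K₀ := ⊤)⟩

instance : (haarProb N).IsMulLeftInvariant := by
  unfold haarProb
  infer_instance

variable {N}

/-- A character as a monoid homomorphism to `ℂ`. -/
def charHom (χ : characterGroup N) : π →* ℂ :=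
  Circle.coeHom.comp (MonoidHom.mk' χ.1 χ.2.1)

lemma charHom_apply (χ : characterGroup N) (g : π) : charHom χ g = χ.1 g := rfl

lemma charHom_of_mem (χ : characterGroup N) {g : π} (hg : g ∈ N) : charHom χ g = 1 := by
  rw [charHom_apply, χ.2.2 g hg, Circle.coe_one]

lemma charHom_mul_left (χ ψ : characterGroup N) (g : π) :
    charHom (χ * ψ) g = charHom χ g * charHom ψ g := by
  simp [charHom_apply]

lemma norm_charHom (χ : characterGroup N) (g : π) : ‖charHom χ g‖ = 1 := Circle.norm_coe _

lemma charHom_ne_zero (χ : characterGroup N) (g : π) : charHom χ g ≠ 0 := Circle.coe_ne_zero _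

lemma charHom_inv (χ : characterGroup N) (g : π) : charHom χ g⁻¹ = conj (charHom χ g) := by
  rw [← Complex.inv_eq_conj (norm_charHom χ g)]
  exact eq_inv_of_mul_eq_one_left (by rw [← map_mul, inv_mul_cancel, map_one])

@[fun_prop]
lemma continuous_charHom (g : π) : Continuous fun χ : characterGroup N => charHom χ g :=
  continuous_subtype_val.comp ((continuous_apply g).comp continuous_subtype_val)

/-- Characters of `π / N` with values in `ℚ/ℤ` separate points; `ℚ/ℤ` embeds in `ℝ/ℤ`, which is the
circle. -/
lemma exists_charHom_ne_one {g : π} (hg : g ∉ N) : ∃ χ : characterGroup N, charHom χ g ≠ 1 := by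
  have h0 : Additive.ofMul (QuotientGroup.mk' N g) ≠ 0 := fun h =>
    hg ((QuotientGroup.eq_one_iff g).mp h)
  obtain ⟨c, hc⟩ := CharacterModule.exists_character_apply_ne_zero_of_ne_zero h0
  set T : AddCircle (1 : ℚ) →+ AddCircle (1 : ℝ) :=
    QuotientAddGroup.map _ _ (Rat.castHom ℝ).toAddMonoidHom (by
      rw [AddSubgroup.zmultiples_le]
      exact AddSubgroup.mem_zmultiples_iff.mpr ⟨1, by simp⟩) with hT
  have hTinj : ∀ x, T x = 0 → x = 0 := by
    intro x
    induction x using QuotientAddGroup.induction_on with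
    | H q =>
      intro h
      have h1 : ((q : ℝ) : AddCircle (1 : ℝ)) = 0 := h
      obtain ⟨n, hn⟩ := (AddCircle.coe_eq_zero_iff _).mp h1
      refine (AddCircle.coe_eq_zero_iff _).mpr ⟨n, ?_⟩
      have : ((n : ℚ) : ℝ) = (q : ℝ) := by simpa using hn
      simpa using Rat.cast_injective (α := ℝ) this
  have hmul : ∀ x y : AddCircle (1 : ℝ), (x + y).toCircle = x.toCircle * y.toCircle :=
    AddCircle.toCircle_add
  refine ⟨⟨fun x => (T (c (Additive.ofMul (QuotientGroup.mk' N x)))).toCircle, ⟨fun a b => ?_,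
    fun n hn => ?_⟩⟩, fun h => ?_⟩
  · beta_reduce
    rw [map_mul, ofMul_mul, map_add, map_add, hmul]
  · have : QuotientGroup.mk' N n = 1 := (QuotientGroup.eq_one_iff n).mpr hn
    beta_reduce
    rw [this, ofMul_one, map_zero, map_zero, AddCircle.toCircle_zero]
  · rw [charHom_apply, ← Circle.coe_one, Circle.coe_inj] at h
    exact hc (hTinj _ (AddCircle.injective_toCircle one_ne_zero (h.trans AddCircle.toCircle_zero.symm)))

lemma integral_charHom_of_mem {g : π} (hg : g ∈ N) : ∫ χ, charHom χ g ∂haarProb N = 1 := by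
  simp [charHom_of_mem _ hg]

/-- Translation by a character `χ₀` with `χ₀(g) ≠ 1` multiplies the integral by `χ₀(g)` but leaves
it unchanged. -/
lemma integral_charHom_of_notMem {g : π} (hg : g ∉ N) : ∫ χ, charHom χ g ∂haarProb N = 0 := by
  obtain ⟨χ₀, h⟩ := exists_charHom_ne_one hg
  have h1 := integral_mul_left_eq_self (μ := haarProb N) (fun χ => charHom χ g) χ₀
  simp only [charHom_mul_left, integral_const_mul] at h1
  have h2 : (charHom χ₀ g - 1) * ∫ χ, charHom χ g ∂haarProb N = 0 := by
    rw [sub_mul, h1, one_mul, sub_self]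
  exact (mul_eq_zero.mp h2).resolve_left (sub_ne_zero.mpr h)

lemma integrable_of_continuous {E : Type*} [NormedAddCommGroup E]
    [SecondCountableTopology E] {f : characterGroup N → E}
    (hf : Continuous f) : Integrable f (haarProb N) :=
  hf.integrable_of_hasCompactSupport (HasCompactSupport.of_compactSpace f)

/-- If the first `M` powers of `g` are distinct modulo `N`, then at most the `M`-th part of the
characters takes the value `1` at `g`. -/
lemma haarProb_charHom_eq_one_le {g : π} {M : ℕ} (hM : 0 < M)
    (hg : ∀ k, 0 < k → k < M → g ^ k ∉ N) :
    (haarProb N).real {χ | charHom χ g = 1} ≤ (M : ℝ)⁻¹ := by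
  set f : characterGroup N → ℂ := fun χ => ∑ k ∈ Finset.range M, charHom χ g ^ k with hf
  have hcont : Continuous f := by fun_prop
  -- The powers `g^k`, `k < M`, are distinct modulo `N`, so they are orthonormal as functions of the
  -- character.
  have hint : ∫ χ, ‖f χ‖ ^ 2 ∂haarProb N = M := by
    have h1 : ∀ χ, ((‖f χ‖ ^ 2 : ℝ) : ℂ) =
        ∑ j ∈ Finset.range M, ∑ k ∈ Finset.range M, charHom χ (g ^ j * (g ^ k)⁻¹) := by
      intro χ
      push_cast
      rw [← Complex.mul_conj', hf]
      simp only [map_sum, Finset.sum_mul_sum, map_mul, charHom_inv, map_pow]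
    have h2 : ∀ j ∈ Finset.range M, ∀ k ∈ Finset.range M,
        ∫ χ, charHom χ (g ^ j * (g ^ k)⁻¹) ∂haarProb N = if j = k then 1 else 0 := by
      intro j hj k hk
      rw [Finset.mem_range] at hj hk
      split_ifs with hjk
      · exact integral_charHom_of_mem (by simp [hjk])
      · refine integral_charHom_of_notMem fun hmem => ?_
        rcases lt_or_gt_of_ne hjk with h | h
        · refine hg (k - j) (by omega) (by omega) ?_
          have := N.inv_mem hmem
          rwa [mul_inv_rev, inv_inv, ← pow_sub g h.le] at this
        · refine hg (j - k) (by omega) (by omega) ?_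
          rwa [← pow_sub g h.le] at hmem
    have h3 : ((∫ χ, ‖f χ‖ ^ 2 ∂haarProb N : ℝ) : ℂ) = M := by
      rw [← integral_complex_ofReal]
      simp only [h1]
      rw [integral_finsetSum _ fun j _ => integrable_of_continuous (by fun_prop)]
      simp_rw [integral_finsetSum _ fun k _ => integrable_of_continuous (continuous_charHom _)]
      rw [Finset.sum_congr rfl fun j hj => (Finset.sum_congr rfl (h2 j hj)).trans
        ((Finset.sum_ite_eq _ _ _).trans (if_pos hj))]
      simp
    exact_mod_cast h3
  -- Where `χ(g) = 1` the sum `f` equals `M`, so Markov's inequality bounds `M²` times the measure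
  -- by `M`.
  have hmarkov := mul_meas_ge_le_integral_of_nonneg (μ := haarProb N)
    (f := fun χ => ‖f χ‖ ^ 2) (Eventually.of_forall fun _ => sq_nonneg _)
    (integrable_of_continuous (by fun_prop)) ((M : ℝ) ^ 2)
  rw [hint] at hmarkov
  have hsub : (haarProb N).real {χ | charHom χ g = 1} ≤
      (haarProb N).real {χ | (M : ℝ) ^ 2 ≤ ‖f χ‖ ^ 2} := by
    refine measureReal_mono fun χ (hχ : charHom χ g = 1) => ?_
    simp [hf, hχ]
  have hMpos : (0 : ℝ) < M := by exact_mod_cast hM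
  rw [← one_div, le_div_iff₀ hMpos]
  have h4 := (mul_le_mul_of_nonneg_left hsub (sq_nonneg (M : ℝ))).trans hmarkov
  nlinarith

/-- A bound for the measure of the zero set of a trigonometric polynomial with `m + 1` terms, if
any two of the characters involved agree on a set of measure at most `t`. -/
def zeroSetBound : ℕ → ℝ → ℝ
  | 0, _ => 0
  | m + 1, t => √(zeroSetBound m t + (m + 1) * t)

lemma zeroSetBound_nonneg (m : ℕ) (t : ℝ) : 0 ≤ zeroSetBound m t := by
  cases m with
  | zero => exact le_rfl
  | succ m => exact Real.sqrt_nonneg _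

lemma tendsto_zeroSetBound (m : ℕ) : Tendsto (zeroSetBound m) (𝓝 0) (𝓝 0) := by
  induction m with
  | zero => exact tendsto_const_nhds
  | succ m ih =>
    have h : Tendsto (fun t : ℝ => zeroSetBound m t + (m + 1) * t) (𝓝 0)
        (𝓝 (0 + (m + 1) * 0)) := ih.add (tendsto_id.const_mul _)
    simpa [zeroSetBound] using h.sqrt

variable [Countable π]

/-- Countability of `π` enters here: it makes multiplication measurable for the product σ-algebra,
as the Fubini argument below requires. -/
instance : SecondCountableTopology (characterGroup N) :=
  inferInstanceAs (SecondCountableTopology (characterGroup N : Set (π → Circle)))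

/-- The measure of the zero set of a trigonometric polynomial, by induction on the number of its
terms: if `χ` and `χ ψ` are zeros of `∑ a_h h`, then `χ` is a zero of
`∑ a_h (ψ(h) - ψ(h₀)) h`, which has one term fewer. -/
lemma haarProb_zeroSet_le {t : ℝ} (m : ℕ) (F : Finset π) (hF : F.card = m + 1) (a : π → ℂ)
    (ha : ∀ h ∈ F, a h ≠ 0)
    (ht : ∀ h ∈ F, ∀ h' ∈ F, h ≠ h' → (haarProb N).real {χ | charHom χ h = charHom χ h'} ≤ t) :
    (haarProb N).real {χ | ∑ h ∈ F, a h * charHom χ h = 0} ≤ zeroSetBound m t := by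
  classical
  induction m generalizing F a with
  | zero =>
    obtain ⟨h, rfl⟩ := Finset.card_eq_one.mp hF
    have : {χ : characterGroup N | ∑ h ∈ {h}, a h * charHom χ h = 0} = ∅ := by
      ext χ
      simp [ha h (by simp), charHom_ne_zero]
    rw [this]
    simp [zeroSetBound]
  | succ m ih =>
    obtain ⟨h₀, hh₀⟩ : F.Nonempty := Finset.card_pos.mp (by omega)
    set μ := haarProb N
    set Z := {χ : characterGroup N | ∑ h ∈ F, a h * charHom χ h = 0} with hZ
    have hZm : MeasurableSet Z := (isClosed_eq (by fun_prop) (by fun_prop)).measurableSet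
    -- The exceptional `ψ`, for which the differenced polynomial loses more than the term of `h₀`.
    set B := {ψ : characterGroup N | ∃ h ∈ F.erase h₀, charHom ψ h = charHom ψ h₀} with hB
    have hBU : B = ⋃ h ∈ F.erase h₀, {ψ : characterGroup N | charHom ψ h = charHom ψ h₀} := by
      ext ψ; simp [hB]
    have hcard : (F.erase h₀).card = m + 1 := by rw [Finset.card_erase_of_mem hh₀, hF]; rfl
    have hBm : MeasurableSet B := by
      rw [hBU]
      exact Finset.measurableSet_biUnion _ fun h _ =>
        (isClosed_eq (by fun_prop) (by fun_prop)).measurableSet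
    have hBle : μ.real B ≤ (m + 1) * t := by
      rw [hBU]
      refine (measureReal_biUnion_finset_le _ _).trans ?_
      refine (Finset.sum_le_card_nsmul _ _ t fun h hh => ?_).trans ?_
      · exact ht h (Finset.mem_of_mem_erase hh) h₀ hh₀ (Finset.ne_of_mem_erase hh)
      · rw [hcard, nsmul_eq_mul]; push_cast; rfl
    set W : Set (characterGroup N × characterGroup N) :=
      (fun z => (z.1, z.1 * z.2)) ⁻¹' (Z ×ˢ Z) with hW
    have hWm : MeasurableSet W := (measurePreserving_prod_mul μ μ).measurable (hZm.prod hZm)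
    -- The shear `(χ, ψ) ↦ (χ, χ ψ)` preserves the product measure.
    have hWμ : (μ.prod μ) W = μ Z * μ Z := by
      rw [(measurePreserving_prod_mul μ μ).measure_preimage (hZm.prod hZm).nullMeasurableSet,
        Measure.prod_prod]
    have hslice : ∀ ψ, μ ((fun χ => (χ, ψ)) ⁻¹' W) ≤
        B.indicator 1 ψ + ENNReal.ofReal (zeroSetBound m t) := by
      intro ψ
      by_cases hψ : ψ ∈ B
      · rw [Set.indicator_of_mem hψ, Pi.one_apply]
        exact prob_le_one.trans le_self_add
      · rw [Set.indicator_of_notMem hψ, zero_add]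
        have hne : ∀ h ∈ F.erase h₀, a h * (charHom ψ h - charHom ψ h₀) ≠ 0 := fun h hh =>
          mul_ne_zero (ha h (Finset.mem_of_mem_erase hh))
            (sub_ne_zero.mpr fun he => hψ ⟨h, hh, he⟩)
        have := ih (F.erase h₀) hcard (fun h => a h * (charHom ψ h - charHom ψ h₀)) hne
          fun h hh h' hh' => ht h (Finset.mem_of_mem_erase hh) h' (Finset.mem_of_mem_erase hh')
        refine le_trans ?_ (ENNReal.ofReal_le_ofReal this)
        rw [ofReal_measureReal]
        refine measure_mono fun χ hχ => ?_
        have h1 : ∑ h ∈ F, a h * charHom χ h = 0 := hχ.1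
        have h2 : ∑ h ∈ F, a h * charHom (χ * ψ) h = 0 := hχ.2
        have h3 : ∑ h ∈ F, a h * (charHom ψ h - charHom ψ h₀) * charHom χ h =
            ∑ h ∈ F, a h * charHom (χ * ψ) h - charHom ψ h₀ * ∑ h ∈ F, a h * charHom χ h := by
          rw [Finset.mul_sum, ← Finset.sum_sub_distrib]
          refine Finset.sum_congr rfl fun h _ => ?_
          rw [charHom_mul_left]
          ring
        rw [h1, h2, ← Finset.add_sum_erase _ _ hh₀] at h3
        simpa using h3
    have hle : μ Z * μ Z ≤ μ B + ENNReal.ofReal (zeroSetBound m t) := by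
      rw [← hWμ, Measure.prod_apply_symm hWm]
      refine (lintegral_mono hslice).trans ?_
      rw [lintegral_add_right _ measurable_const, lintegral_indicator_one hBm]
      simp
    have hreal : μ.real Z * μ.real Z ≤ μ.real B + zeroSetBound m t := by
      have := ENNReal.toReal_mono (by finiteness) hle
      rwa [ENNReal.toReal_mul, ENNReal.toReal_add (by finiteness) (by finiteness),
        ENNReal.toReal_ofReal (zeroSetBound_nonneg m t)] at this
    rw [zeroSetBound]
    refine Real.le_sqrt_of_sq_le ?_
    rw [sq]
    linarith

end Characters

/-! ### Functoriality of the group ring -/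

section GroupRingMaps

variable {π G : Type*} [Group π] [Group G] {d : ℕ}

@[simp] lemma groupRingStar_zero : groupRingStar (0 : MonoidAlgebra ℂ π) = 0 := by
  simp [groupRingStar]

lemma groupRingStar_add (a b : MonoidAlgebra ℂ π) :
    groupRingStar (a + b) = groupRingStar a + groupRingStar b := by
  classical
  rw [groupRingStar, MonoidAlgebra.coeff_add]
  exact Finsupp.sum_add_index' (by simp) (by simp [MonoidAlgebra.single_add])

@[simp] lemma groupRingStar_single (g : π) (c : ℂ) :
    groupRingStar (MonoidAlgebra.single g c) = MonoidAlgebra.single g⁻¹ (conj c) := by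
  rw [groupRingStar, MonoidAlgebra.coeff_single, Finsupp.sum_single_index (by simp)]

lemma groupRingStar_mapDomain (p : π →* G) (a : MonoidAlgebra ℂ π) :
    groupRingStar (MonoidAlgebra.mapDomainRingHom ℂ p a) =
      MonoidAlgebra.mapDomainRingHom ℂ p (groupRingStar a) := by
  induction a using MonoidAlgebra.induction_linear with
  | zero => simp
  | add x y hx hy => simp only [map_add, groupRingStar_add, hx, hy]
  | single g c => simp

lemma mapMatrix_eq (p : π →* G) (X : Matrix (Fin d) (Fin d) (MonoidAlgebra ℂ π)) :
    mapMatrix p X = (MonoidAlgebra.mapDomainRingHom ℂ p).mapMatrix X := rfl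

lemma mapMatrix_mul (p : π →* G) (X Y : Matrix (Fin d) (Fin d) (MonoidAlgebra ℂ π)) :
    mapMatrix p (X * Y) = mapMatrix p X * mapMatrix p Y := by
  simp only [mapMatrix_eq, map_mul]

lemma mapMatrix_mapMatrix {G' : Type*} [Group G'] (p : π →* G) (q : G →* G')
    (X : Matrix (Fin d) (Fin d) (MonoidAlgebra ℂ π)) :
    mapMatrix q (mapMatrix p X) = mapMatrix (q.comp p) X := by
  refine Matrix.ext fun i j => ?_
  simp only [mapMatrix, Matrix.map_apply]
  induction X i j using MonoidAlgebra.induction_linear with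
  | zero => simp
  | add x y hx hy => simp only [map_add, hx, hy]
  | single g c => simp

lemma adjointMatrix_mapMatrix (p : π →* G) (X : Matrix (Fin d) (Fin d) (MonoidAlgebra ℂ π)) :
    adjointMatrix (mapMatrix p X) = mapMatrix p (adjointMatrix X) := by
  refine Matrix.ext fun i j => ?_
  exact groupRingStar_mapDomain p _

lemma laplacian_mapMatrix (p : π →* G) (X : Matrix (Fin d) (Fin d) (MonoidAlgebra ℂ π)) :
    laplacian (mapMatrix p X) = mapMatrix p (laplacian X) := by
  rw [laplacian, laplacian, mapMatrix_mul, adjointMatrix_mapMatrix]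

end GroupRingMaps

/-! ### Fourier transform and diagonal matrices -/

section Evaluation

variable {π : Type*} [CommGroup π] {N : Subgroup π}

/-- The evaluation of elements of the group ring at a character. -/
def charEval (χ : characterGroup N) : MonoidAlgebra ℂ π →ₐ[ℂ] ℂ :=
  MonoidAlgebra.lift ℂ ℂ π (charHom χ)

lemma charEval_apply (χ : characterGroup N) (a : MonoidAlgebra ℂ π) :
    charEval χ a = ∑ g ∈ a.coeff.support, a.coeff g * charHom χ g := by
  simp only [charEval, MonoidAlgebra.lift_apply, Finsupp.sum, smul_eq_mul]

@[fun_prop]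
lemma continuous_charEval (a : MonoidAlgebra ℂ π) :
    Continuous fun χ : characterGroup N => charEval χ a := by
  simp only [charEval_apply]
  fun_prop

lemma norm_charEval_le (χ : characterGroup N) (a : MonoidAlgebra ℂ π) :
    ‖charEval χ a‖ ≤ ∑ g ∈ a.coeff.support, ‖a.coeff g‖ := by
  rw [charEval_apply]
  refine (norm_sum_le _ _).trans (le_of_eq ?_)
  simp [norm_charHom]

lemma charEval_groupRingStar (χ : characterGroup N) (a : MonoidAlgebra ℂ π) :
    charEval χ (groupRingStar a) = conj (charEval χ a) := by
  induction a using MonoidAlgebra.induction_linear with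
  | zero => simp
  | add x y hx hy => simp only [map_add, groupRingStar_add, hx, hy]
  | single g c => simp [charEval, charHom_inv]

/-- Fourier inversion at the unit element. -/
lemma coeff_one_mapDomain {G : Type*} [Group G] (p : π →* G) (a : MonoidAlgebra ℂ π) :
    (MonoidAlgebra.mapDomainRingHom ℂ p a).coeff 1 = ∫ χ, charEval χ a ∂haarProb p.ker := by
  induction a using MonoidAlgebra.induction_linear with
  | zero => simp
  | add x y hx hy =>
    simp only [map_add, MonoidAlgebra.coeff_add, Finsupp.add_apply, hx, hy]
    rw [integral_add (integrable_of_continuous (by fun_prop))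
      (integrable_of_continuous (by fun_prop))]
  | single g c =>
    simp only [charEval, MonoidAlgebra.lift_single, smul_eq_mul, integral_const_mul]
    by_cases hg : g ∈ p.ker
    · rw [integral_charHom_of_mem hg]
      simp [MonoidHom.mem_ker.mp hg]
    · rw [integral_charHom_of_notMem hg]
      have : p g ≠ 1 := hg
      simp [this]

/-- The kernel of a diagonal matrix over `ℂπ`, acting through a homomorphism `p : π → G`, has as its
dimension the measure of the zero sets of the diagonal entries. -/
lemma kerDim_mapMatrix_diagonal {G : Type*} [Group G] {d : ℕ} (p : π →* G)
    (D : Fin d → MonoidAlgebra ℂ π) :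
    kerDim (matrixOp (mapMatrix p (Matrix.diagonal D))) =
      ∑ k, (haarProb p.ker).real {χ | charEval χ (D k) = 0} := by
  set μ := haarProb p.ker
  set S := matrixOp (mapMatrix p (Matrix.diagonal D))
  set C : Fin d → ℝ := fun k => ∑ g ∈ (D k).coeff.support, ‖(D k).coeff g‖
  -- `t` is small for the operator, as the ergodic theorem requires, and for the `ℓ¹` norms `C k`,
  -- which bound `D k` at all characters and keep `1 - t |D k|²` in `[0, 1]`.
  obtain ⟨t, ⟨hS, hC⟩, ht⟩ := (((eventually_mul_le_one (‖S‖ ^ 2)).and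
    (eventually_all.mpr fun k => eventually_mul_le_one (C k ^ 2))).and self_mem_nhdsWithin).exists
  have ht : 0 < t := ht
  have key := tendsto_average_coeffTrace (laplacian (mapMatrix p (Matrix.diagonal D))) S
    (by rw [laplacian, matrixOp_mul, matrixOp_adjointMatrix]) ht (hS.trans one_le_two)
  have hlap : laplacian (Matrix.diagonal D) =
      Matrix.diagonal fun k => groupRingStar (D k) * D k := by
    rw [laplacian, ← Matrix.diagonal_mul_diagonal]
    congr 1
    ext i j : 2
    by_cases hij : i = j
    · subst hij; simp [adjointMatrix]
    · simp [adjointMatrix, hij, Ne.symm hij]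
  have hpow : ∀ j : ℕ, (1 - (t : ℂ) • laplacian (mapMatrix p (Matrix.diagonal D))) ^ j =
      mapMatrix p (Matrix.diagonal fun k => (1 - (t : ℂ) • (groupRingStar (D k) * D k)) ^ j) := by
    intro j
    have h1 : Matrix.diagonal (fun k => (1 - (t : ℂ) • (groupRingStar (D k) * D k)) ^ j) =
        (1 - (t : ℂ) • laplacian (Matrix.diagonal D)) ^ j := by
      rw [hlap, ← Matrix.diagonal_one, ← Matrix.diagonal_smul, Matrix.diagonal_sub,
        Matrix.diagonal_pow]
      rfl
    rw [h1, laplacian_mapMatrix, mapMatrix_eq, mapMatrix_eq, map_pow, map_sub, map_one]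
    congr 2
    ext i j : 2
    simp [MonoidAlgebra.mapDomain_smul]
  set y : Fin d → characterGroup p.ker → ℝ := fun k χ => 1 - t * ‖charEval χ (D k)‖ ^ 2
  have hy1 : ∀ k χ, y k χ ≤ 1 := fun k χ => by
    have : 0 ≤ t * ‖charEval χ (D k)‖ ^ 2 := by positivity
    simp only [y]; linarith
  have hy0 : ∀ k χ, 0 ≤ y k χ := fun k χ => by
    have h1 : t * ‖charEval χ (D k)‖ ^ 2 ≤ t * C k ^ 2 := by
      gcongr
      exact norm_charEval_le χ (D k)
    have := h1.trans (hC k)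
    simp only [y]; linarith
  have hyc : ∀ k, Continuous (y k) := fun k => by simp only [y]; fun_prop
  have htrace : ∀ j : ℕ,
      (coeffTrace ((1 - (t : ℂ) • laplacian (mapMatrix p (Matrix.diagonal D))) ^ j)).re =
        ∑ k, ∫ χ, y k χ ^ j ∂μ := by
    intro j
    rw [hpow, coeffTrace, Complex.re_sum]
    refine Finset.sum_congr rfl fun k _ => ?_
    rw [mapMatrix, Matrix.map_apply, Matrix.diagonal_apply_eq, coeff_one_mapDomain]
    have : ∀ χ : characterGroup p.ker,
        charEval χ ((1 - (t : ℂ) • (groupRingStar (D k) * D k)) ^ j) = ((y k χ ^ j : ℝ) : ℂ) := by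
      intro χ
      rw [map_pow, map_sub, map_one, map_smul, map_mul, charEval_groupRingStar, Complex.conj_mul']
      simp [y]
    simp only [this]
    rw [integral_complex_ofReal, Complex.ofReal_re]
  simp only [htrace] at key
  -- The powers `y k χ ^ j` decrease to the indicator of the zero set; convergence of the integrals
  -- then implies convergence of their Cesàro means to the same limit.
  have hlim : ∀ k, Tendsto (fun j : ℕ => ∫ χ, y k χ ^ j ∂μ) atTop
      (𝓝 (μ.real {χ | charEval χ (D k) = 0})) := by
    intro k
    have hm : MeasurableSet {χ : characterGroup p.ker | charEval χ (D k) = 0} :=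
      (isClosed_eq (by fun_prop) (by fun_prop)).measurableSet
    rw [← integral_indicator_one hm]
    refine tendsto_integral_of_dominated_convergence (fun _ => (1 : ℝ))
      (fun j => ((hyc k).pow j).aestronglyMeasurable) (integrable_const _)
      (fun j => Eventually.of_forall fun χ => ?_) (Eventually.of_forall fun χ => ?_)
    · rw [Real.norm_of_nonneg (pow_nonneg (hy0 k χ) j)]
      exact pow_le_one₀ (hy0 k χ) (hy1 k χ)
    · by_cases hχ : charEval χ (D k) = 0
      · rw [Set.indicator_of_mem (by exact hχ)]
        simp [y, hχ]
      · rw [Set.indicator_of_notMem (by exact hχ)]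
        refine tendsto_pow_atTop_nhds_zero_of_lt_one (hy0 k χ) ?_
        have : 0 < t * ‖charEval χ (D k)‖ ^ 2 := by positivity
        simp only [y]; linarith
  exact tendsto_nhds_unique key (tendsto_finsetSum _ fun k _ => hlim k).cesaro

end Evaluation

/-! ### Limits along a family of homomorphisms, diagonal case -/

section Family

variable {π : Type*} [CommGroup π] [Countable π] [IsMulTorsionFree π]
  {I : Type*} {l : Filter I} {G : I → Type*} [∀ i, Group (G i)] (p : ∀ i, π →* G i)

lemma tendsto_haarProb_zeroSet (hp : ∀ g, g ≠ 1 → ∀ᶠ i in l, p i g ≠ 1)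
    {a : MonoidAlgebra ℂ π} (ha : a ≠ 0) :
    Tendsto (fun i => (haarProb (p i).ker).real {χ | charEval χ a = 0}) l (𝓝 0) := by
  obtain ⟨m, hm⟩ : ∃ m, a.coeff.support.card = m + 1 :=
    Nat.exists_eq_succ_of_ne_zero (Finset.card_ne_zero.mpr
      (Finsupp.support_nonempty_iff.mpr (by simpa using ha)))
  have hbound : ∀ M : ℕ, 0 < M → ∀ᶠ i in l,
      (haarProb (p i).ker).real {χ | charEval χ a = 0} ≤ zeroSetBound m (M : ℝ)⁻¹ := by
    intro M hM
    -- Only finitely many elements `(h / h')^k` occur, and for `h ≠ h'`, `k > 0` they are nontrivial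
    -- by torsion-freeness.
    have hev : ∀ᶠ i in l, ∀ h ∈ a.coeff.support, ∀ h' ∈ a.coeff.support, ∀ k ∈ Finset.range M,
        h ≠ h' → 0 < k → p i ((h / h') ^ k) ≠ 1 := by
      simp only [Filter.eventually_all_finset]
      intro h _ h' _ k _
      by_cases hh : h ≠ h' ∧ 0 < k
      · filter_upwards [hp ((h / h') ^ k) (by
          rw [Ne, pow_eq_one_iff_left hh.2.ne', div_eq_one]; exact hh.1)] with i hi _ _ using hi
      · exact Eventually.of_forall fun i h1 h2 => absurd ⟨h1, h2⟩ hh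
    filter_upwards [hev] with i hi
    simp only [charEval_apply]
    refine haarProb_zeroSet_le m _ hm _ (fun h hh => Finsupp.mem_support_iff.mp hh) ?_
    intro h hh h' hh' hne
    have hset : {χ : characterGroup (p i).ker | charHom χ h = charHom χ h'} =
        {χ | charHom χ (h / h') = 1} := by
      ext χ
      have h1 : charHom χ (h / h') * charHom χ h' = charHom χ h := by rw [← map_mul, div_mul_cancel]
      have h2 := charHom_ne_zero χ h'
      simp only [Set.mem_ofPred_eq, ← h1, mul_eq_right₀ h2]
    rw [hset]
    exact haarProb_charHom_eq_one_le hM fun k hk hkM =>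
      hi h hh h' hh' k (Finset.mem_range.mpr hkM) hne hk
  rw [Metric.tendsto_nhds]
  intro ε hε
  have hM : ∀ᶠ M : ℕ in atTop, zeroSetBound m (M : ℝ)⁻¹ < ε :=
    ((tendsto_zeroSetBound m).comp tendsto_inv_atTop_nhds_zero_nat).eventually_lt_const hε
  obtain ⟨M, hM1, hM2⟩ := (hM.and (eventually_gt_atTop 0)).exists
  filter_upwards [hbound M hM2] with i hi
  rw [Real.dist_0_eq_abs, abs_of_nonneg measureReal_nonneg]
  exact hi.trans_lt hM1

lemma tendsto_kerDim_diagonal (hp : ∀ g, g ≠ 1 → ∀ᶠ i in l, p i g ≠ 1) {d : ℕ}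
    (D : Fin d → MonoidAlgebra ℂ π) :
    Tendsto (fun i => kerDim (matrixOp (mapMatrix (p i) (Matrix.diagonal D)))) l
      (𝓝 (Nat.card {k // D k = 0})) := by
  classical
  simp only [kerDim_mapMatrix_diagonal]
  have h : ((Nat.card {k // D k = 0} : ℕ) : ℝ) = ∑ k, if D k = 0 then 1 else 0 := by
    rw [Nat.card_eq_fintype_card, Fintype.card_subtype, Finset.sum_boole]
  rw [h]
  refine tendsto_finsetSum _ fun k _ => ?_
  split_ifs with hk
  · simpa [hk] using tendsto_const_nhds
  · exact tendsto_haarProb_zeroSet p hp hk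

end Family

/-! ### Diagonalization over a domain up to scalars -/

section Diagonalization

variable {R : Type*} [CommRing R] [IsDomain R] {n : Type*} [Fintype n]

lemma exists_map_eq_smul (P : Matrix n n (FractionRing R)) :
    ∃ s : R, s ≠ 0 ∧ ∃ Q : Matrix n n R,
      Q.map (algebraMap R (FractionRing R)) = algebraMap R (FractionRing R) s • P := by
  obtain ⟨b, hb⟩ := IsLocalization.exist_integer_multiples_of_finite (nonZeroDivisors R)
    (fun ij : n × n => P ij.1 ij.2)
  choose q hq using hb
  refine ⟨b, nonZeroDivisors.ne_zero b.2, Matrix.of fun i j => q (i, j), ?_⟩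
  ext i j
  rw [Matrix.map_apply, Matrix.of_apply, hq, Matrix.smul_apply, smul_eq_mul, Algebra.smul_def]

variable [DecidableEq n] in
/-- A square matrix over a domain is equivalent to a diagonal matrix up to nonzero scalars. -/
lemma exists_mul_mul_eq_diagonal (A : Matrix n n R) :
    ∃ (U V U' V' : Matrix n n R) (D : n → R) (c₁ c₂ : R), c₁ ≠ 0 ∧ c₂ ≠ 0 ∧
      U * A * V = Matrix.diagonal D ∧ U' * U = Matrix.diagonal (fun _ => c₁) ∧
      V * V' = Matrix.diagonal (fun _ => c₂) := by
  set φ := algebraMap R (FractionRing R)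
  have hφ : Function.Injective φ := IsFractionRing.injective R (FractionRing R)
  have hmap : Function.Injective fun M : Matrix n n R => M.map φ := Matrix.map_injective hφ
  obtain ⟨L, L', D₀, h⟩ :=
    Matrix.Pivot.exists_list_transvec_mul_mul_list_transvec_eq_diagonal (A.map φ)
  have hdet := fun L : List (Matrix.TransvectionStruct n (FractionRing R)) =>
    Matrix.TransvectionStruct.det_toMatrix_prod L
  set P := (L.map Matrix.TransvectionStruct.toMatrix).prod
  set P' := (L'.map Matrix.TransvectionStruct.toMatrix).prod
  have hP : IsUnit P.det := by rw [hdet L]; exact isUnit_one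
  have hP' : IsUnit P'.det := by rw [hdet L']; exact isUnit_one
  obtain ⟨s₁, hs₁, U, hU⟩ := exists_map_eq_smul P
  obtain ⟨s₂, hs₂, V, hV⟩ := exists_map_eq_smul P'
  obtain ⟨s₃, hs₃, U', hU'⟩ := exists_map_eq_smul P⁻¹
  obtain ⟨s₄, hs₄, V', hV'⟩ := exists_map_eq_smul P'⁻¹
  -- The scalars are products of the common denominators cleared from a product of transvections and
  -- from its inverse.
  refine ⟨U, V, U', V', fun k => (U * A * V) k k, s₃ * s₁, s₂ * s₄, mul_ne_zero hs₃ hs₁,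
    mul_ne_zero hs₂ hs₄, ?_, hmap ?_, hmap ?_⟩
  · have h1 : (U * A * V).map φ = (φ s₂ * φ s₁) • Matrix.diagonal D₀ := by
      rw [Matrix.map_mul, Matrix.map_mul, hU, hV, ← h, smul_mul_assoc, smul_mul_assoc,
        mul_smul_comm, smul_smul, mul_comm]
    ext i j
    by_cases hij : i = j
    · subst hij; simp
    · rw [Matrix.diagonal_apply_ne _ hij]
      apply hφ
      have := congrFun (congrFun h1 i) j
      rw [Matrix.map_apply, Matrix.smul_apply, Matrix.diagonal_apply_ne _ hij, smul_zero] at this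
      rw [this, map_zero]
  · beta_reduce
    rw [Matrix.map_mul, hU, hU', smul_mul_smul_comm, Matrix.nonsing_inv_mul _ hP,
      Matrix.diagonal_map (map_zero φ), ← map_mul, ← Matrix.diagonal_one, ← Matrix.diagonal_smul]
    congr 1
    ext
    simp [φ]
  · beta_reduce
    rw [Matrix.map_mul, hV, hV', smul_mul_smul_comm, Matrix.mul_nonsing_inv _ hP',
      Matrix.diagonal_map (map_zero φ), ← map_mul, ← Matrix.diagonal_one, ← Matrix.diagonal_smul]
    congr 1
    ext
    simp [φ]

end Diagonalization

/-! ### The approximation theorem for torsion-free abelian groups -/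

section Approximation

lemma diagonal_const_mul_comm {R n : Type*} [CommRing R] [Fintype n] [DecidableEq n] (c : R)
    (B : Matrix n n R) :
    Matrix.diagonal (fun _ => c) * B = B * Matrix.diagonal fun _ => c := by
  ext i j
  rw [Matrix.diagonal_mul, Matrix.mul_diagonal, mul_comm]

/-- Although `ℂG` need not be commutative, the image of a scalar over `ℂπ` commutes with the images
of `B` and `B^*`, so subadditivity applies. -/
lemma kerDim_mapMatrix_scalar_mul_le {π G : Type*} [CommGroup π] [Group G] (p : π →* G) {d : ℕ}
    (c : MonoidAlgebra ℂ π) (B : Matrix (Fin d) (Fin d) (MonoidAlgebra ℂ π)) :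
    kerDim (matrixOp (mapMatrix p (Matrix.diagonal (fun _ => c) * B))) ≤
      kerDim (matrixOp (mapMatrix p (Matrix.diagonal fun _ : Fin d => c))) +
        kerDim (matrixOp (mapMatrix p B)) := by
  rw [mapMatrix_mul]
  refine kerDim_mul_le _ _ ?_ ?_
  · rw [← mapMatrix_mul, diagonal_const_mul_comm, mapMatrix_mul]
  · rw [adjointMatrix_mapMatrix, ← mapMatrix_mul, diagonal_const_mul_comm, mapMatrix_mul]

/-- If `U A V` is diagonal for matrices `U` and `V` that are invertible up to nonzero scalars, then
the dimension of the kernel of `p_i(A)` converges to the number of zeros on the diagonal. -/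
lemma tendsto_kerDim_of_mul_mul_eq_diagonal {π : Type*} [CommGroup π] [Countable π]
    [IsMulTorsionFree π] {I : Type*} {l : Filter I} {G : I → Type*} [∀ i, Group (G i)]
    (p : ∀ i, π →* G i) (hp : ∀ g, g ≠ 1 → ∀ᶠ i in l, p i g ≠ 1) {d : ℕ}
    {A U V U' V' : Matrix (Fin d) (Fin d) (MonoidAlgebra ℂ π)} {D : Fin d → MonoidAlgebra ℂ π}
    {c₁ c₂ : MonoidAlgebra ℂ π} (hc₁ : c₁ ≠ 0) (hc₂ : c₂ ≠ 0)
    (hD : U * A * V = Matrix.diagonal D) (hU : U' * U = Matrix.diagonal fun _ => c₁)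
    (hV : V * V' = Matrix.diagonal fun _ => c₂) :
    Tendsto (fun i => kerDim (matrixOp (mapMatrix (p i) A))) l (𝓝 (Nat.card {k // D k = 0})) := by
  set ν : ∀ i, Matrix (Fin d) (Fin d) (MonoidAlgebra ℂ π) → ℝ :=
    fun i X => kerDim (matrixOp (mapMatrix (p i) X)) with hν
  have hleft : ∀ i X Y, ν i Y ≤ ν i (X * Y) := fun i X Y => by
    simp only [hν, mapMatrix_mul]
    exact kerDim_le_mul_left _ _
  have hright : ∀ i X Y, ν i X ≤ ν i (X * Y) := fun i X Y => by
    simp only [hν, mapMatrix_mul]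
    exact kerDim_le_mul_right _ _
  have hscalar : ∀ {c : MonoidAlgebra ℂ π}, c ≠ 0 →
      Tendsto (fun i => ν i (Matrix.diagonal fun _ => c)) l (𝓝 0) := fun {c} hc => by
    simpa [hc] using tendsto_kerDim_diagonal p hp fun _ : Fin d => c
  have hdiag := tendsto_kerDim_diagonal p hp D
  have hupper : ∀ i, ν i A ≤ ν i (Matrix.diagonal D) := fun i => by
    rw [← hD, mul_assoc]
    exact (hright i A V).trans (hleft i U _)
  -- Multiplying `U A V` by `U'` on the left and then `A V` by `V'` on the right leaves only the
  -- scalars `c₁` and `c₂` to be removed.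
  have hlower : ∀ i, ν i (Matrix.diagonal D) -
      (ν i (Matrix.diagonal fun _ => c₁) + ν i (Matrix.diagonal fun _ => c₂)) ≤ ν i A := fun i => by
    have h1 : ν i (Matrix.diagonal D) ≤ ν i (Matrix.diagonal (fun _ => c₁) * (A * V)) := by
      rw [← hU, mul_assoc, ← mul_assoc U, hD]
      exact hleft i _ _
    have h2 : ν i (A * V) ≤ ν i (Matrix.diagonal (fun _ => c₂) * A) := by
      rw [diagonal_const_mul_comm, ← hV, ← mul_assoc]
      exact hright i _ _
    have h3 : ν i (Matrix.diagonal (fun _ => c₁) * (A * V)) ≤ _ :=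
      kerDim_mapMatrix_scalar_mul_le (p i) c₁ (A * V)
    have h4 : ν i (Matrix.diagonal (fun _ => c₂) * A) ≤ _ :=
      kerDim_mapMatrix_scalar_mul_le (p i) c₂ A
    simp only [hν] at h1 h2 h3 h4 ⊢
    linarith
  refine tendsto_of_tendsto_of_tendsto_of_le_of_le ?_ hdiag hlower hupper
  simpa using hdiag.sub ((hscalar hc₁).add (hscalar hc₂))

lemma countable_of_fg (H : Type*) [CommGroup H] [Group.FG H] : Countable H := by
  obtain ⟨n, f, hf⟩ := Module.Finite.exists_fin' ℤ (Additive H)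
  exact hf.countable

/-- A matrix over a group ring is defined over a finitely generated subgroup. -/
lemma exists_mapMatrix_subtype_eq {π : Type*} [Group π] {d : ℕ}
    (A : Matrix (Fin d) (Fin d) (MonoidAlgebra ℂ π)) :
    ∃ (H : Subgroup π) (_ : Group.FG H) (A₀ : Matrix (Fin d) (Fin d) (MonoidAlgebra ℂ H)),
      mapMatrix H.subtype A₀ = A := by
  classical
  set S : Finset π := Finset.univ.biUnion fun ij : Fin d × Fin d => (A ij.1 ij.2).coeff.support
  refine ⟨Subgroup.closure S, inferInstance, Matrix.of fun i j =>
    MonoidAlgebra.comapDomain (Subgroup.closure (S : Set π)).subtype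
      (Subgroup.subtype_injective _) (A i j), ?_⟩
  refine Matrix.ext fun i j => MonoidAlgebra.mapDomain_comapDomain ?_
    (Subgroup.subtype_injective _)
  intro g hg
  rw [Subgroup.coe_subtype, Subtype.range_coe]
  exact Subgroup.subset_closure (Finset.mem_coe.mpr
    (Finset.mem_biUnion.mpr ⟨(i, j), Finset.mem_univ _, hg⟩))

/-- The approximation theorem for a torsion-free abelian group and a family of homomorphisms whose
kernels eventually avoid each nontrivial element. -/
theorem tendsto_spectralDensity_laplacian {π : Type*} [CommGroup π] [IsMulTorsionFree π]
    {I : Type*} {l : Filter I} {G : I → Type*} [∀ i, Group (G i)] (p : ∀ i, π →* G i)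
    (hp : ∀ g, g ≠ 1 → ∀ᶠ i in l, p i g ≠ 1) {d : ℕ}
    (A : Matrix (Fin d) (Fin d) (MonoidAlgebra ℂ π)) :
    Tendsto (fun i => spectralDensity (laplacian (mapMatrix (p i) A)) 0) l
      (𝓝 (spectralDensity (laplacian A) 0)) := by
  obtain ⟨H, _, A₀, rfl⟩ := exists_mapMatrix_subtype_eq A
  have := countable_of_fg H
  obtain ⟨U, V, U', V', D, c₁, c₂, hc₁, hc₂, hD, hU, hV⟩ := exists_mul_mul_eq_diagonal A₀
  have h1 := tendsto_kerDim_of_mul_mul_eq_diagonal (l := l) (fun i => (p i).comp H.subtype)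
    (fun g hg => hp g (by simpa using hg)) hc₁ hc₂ hD hU hV
  -- The same result for the constant family given by the inclusion `H → π` identifies the number of
  -- zeros with the kernel dimension over `π`.
  have h2 := tendsto_kerDim_of_mul_mul_eq_diagonal (l := pure ()) (fun _ : Unit => H.subtype)
    (fun g hg => by simpa using hg) hc₁ hc₂ hD hU hV
  have h3 := tendsto_nhds_unique h2 tendsto_const_nhds
  simp only [spectralDensity_laplacian_zero, mapMatrix_mapMatrix]
  rwa [h3] at h1

end Approximation

end L2Approx

end

/-! ### Inverse limits and nested sequences of subgroups -/

theorem mainTheorem9 {π : Type*} [CommGroup π] (hfree : Module.Free ℤ (Additive π)) :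
    (∀ {I : Type*} [Preorder I] [IsDirectedOrder I] [Nonempty I]
      (G : I → Type*) [∀ i, Group (G i)]
      (f : ∀ ⦃i j : I⦄, i ≤ j → G j →* G i) [InverseSystem fun ⦃i j : I⦄ (h : i ≤ j) => ⇑(f h)]
      (ι : π →* L2Approx.inverseLimit f) (_hι : Function.Injective ι)
      (d : ℕ) (A : Matrix (Fin d) (Fin d) (MonoidAlgebra ℂ π)),
      Tendsto
        (fun i => L2Approx.spectralDensity (L2Approx.laplacian
          (L2Approx.mapMatrix ((L2Approx.inverseLimitProj f i).comp ι) A)) 0)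
        atTop (𝓝 (L2Approx.spectralDensity (L2Approx.laplacian A) 0))) ∧
    (∀ (N : ℕ → Subgroup π) (_hN : Antitone N) (_hbot : ⨅ n, N n = ⊥)
      (d : ℕ) (A : Matrix (Fin d) (Fin d) (MonoidAlgebra ℂ π)),
      Tendsto
        (fun n => L2Approx.spectralDensity (L2Approx.laplacian
          (L2Approx.mapMatrix (QuotientGroup.mk' (N n)) A)) 0)
        atTop (𝓝 (L2Approx.spectralDensity (L2Approx.laplacian A) 0))) := by
  have hadd : IsAddTorsionFree (Additive π) :=
    Module.isTorsionFree_int_iff_isAddTorsionFree.mp inferInstance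
  have htf : IsMulTorsionFree π :=
    inferInstanceAs (IsMulTorsionFree (Multiplicative (Additive π)))
  refine ⟨?_, ?_⟩
  · intro I _ _ _ G _ f _ ι hι d A
    refine L2Approx.tendsto_spectralDensity_laplacian _ (fun g hg => ?_) A
    obtain ⟨i₀, hi₀⟩ : ∃ i, (ι g).1 i ≠ 1 := by
      by_contra! h
      refine hg (hι ?_)
      rw [map_one]
      exact Subtype.ext (funext h)
    -- A coherent family trivial at `i` is trivial at every smaller index, so `g` stays nontrivial
    -- from `i₀` on.
    filter_upwards [eventually_ge_atTop i₀] with i hi h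
    refine hi₀ ?_
    rw [← (ι g).2 hi, show (ι g).1 i = 1 from h, map_one]
  · intro N hN hbot d A
    refine L2Approx.tendsto_spectralDensity_laplacian _ (fun g hg => ?_) A
    obtain ⟨n₀, hn₀⟩ : ∃ n, g ∉ N n := by
      by_contra! h
      refine hg (Subgroup.mem_bot.mp ?_)
      rw [← hbot]
      exact Subgroup.mem_iInf.mpr h
    filter_upwards [eventually_ge_atTop n₀] with n hn h
    exact hn₀ (hN hn ((QuotientGroup.eq_one_iff g).mp h))
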